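/- **Snake and band graphs.** A snake graph is a single edge, or a sequence of unit square tiles $G_1,\dots,G_d$ ($d\ge 1$) in the plane in which $G_{i+1}$ is glued to the north or to the east edge of $G_i$; $e_i$ denotes the interior edge shared by $G_i$ and $G_{i+1}$. It carries a sign function $f$ (edges $\to\{+,-\}$; in each tile north and west have one sign, south and east the opposite one), and its minimal matching is the perfect matching consisting of boundary edges whose edge at the south-west corner has sign $-$. A band graph $\mathcal G^b$ is obtained from a snake graph $\mathcal G$ with at least one tile by identifying an edge $b$ at the south-west corner with the edge of the same sign at the north-east corner. Isomorphisms are isomorphisms of such graphs which respect the tiles and the minimal matching. A snake or band graph is *geometric* if it is the snake graph of an arc, or the band graph of a closed curve, in some triangulated oriented surface with marked points $(S,M,T)$ (an arc of $T$ gives the single edge, a curve crossing arcs of $T$ in $d$ points gives a graph with $d$ tiles, and the sign of $e_i$ records on which side of the curve lies the third side of the triangle traversed between the $i$-th and the $(i+1)$-st crossing). It is *unpunctured* if $(S,M)$ can be chosen without punctures, i.e. with all marked points on the boundary. **The rings.** Let $\mathcal{XYR}$ (respectively $\mathcal{XYR}_{geo}$) be the free $\mathbb Z[y]$-module with basis the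 isomorphism classes of finite disjoint unions of unpunctured (respectively geometric) snake and band graphs, all of whose edges are labeled $x$ and all of whose tiles are labeled $y$, with the disjoint union as multiplication and $1=\emptyset$. The *ideal of resolutions* is generated by all elements $$\mathcal G_{12}-y_{34}\,\mathcal G_{34}-y_{56}\,\mathcal G_{56}$$ whose terms lie in the ring, where $\mathcal G_{12}=y_{34}\mathcal G_{34}+y_{56}\mathcal G_{56}$ runs over the resolutions of snake graph calculus (the combinatorial form of the skein relations, with the powers $y_{34},y_{56}$ of $y$ prescribed by the minimal matchings) of: a crossing overlap of two snake graphs, of a snake graph and a band graph, or of two band graphs; a crossing self-overlap of a snake graph or of a band graph; a grafting of two snake graphs, a self-grafting of a snake graph, or a grafting of a snake graph and a band graph. Let $\mathcal{XYS}$ and $\mathcal{XYS}_{geo}$ be the quotients of $\mathcal{XYR}$ and $\mathcal{XYR}_{geo}$ by their ideals of resolutions. **Theorem.** (a) The unpunctured ring $\mathcal{XYS}$ is generated, as a $\mathbb Z[y]$-algebra, by the single edge, the snake graph consisting of a single tile, and all unpunctured band graphs. (b) The geometric ring $\mathcal{XYS}_{geo}$ is generated, as a $\mathbb Z[y]$-algebra,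 by the single edge and the band graph consisting of a single tile. -/

import Mathlib

open scoped Polynomial

namespace SnakeCalc

/-! ### Snake graphs and band graphs

A sign is a `Bool` (`true` is `+`, `false` is `-`).  A snake graph with tiles `G_1, …, G_d` (`d ≥ 1`)
and a sign function is recorded by the word of the signs of its interior edges `e_1, …, e_{d-1}`:
the next tile is added at the unique edge of `^{NE}G_i` having the prescribed sign.  The sign
function is part of the data: the minimal matching is the boundary matching whose edge at the
south-west corner has sign `-`. -/

/-- A snake graph with sign function: a single edge, or the graph with `w.length + 1` tiles
whose consecutive interior edges have the signs listed in `w`. -/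
inductive Snake where
  | edge : Snake
  | tiles (w : List Bool) : Snake

/-- The word of the opposite snake graph: reading a snake graph from north-east to south-west
reverses the sequence of interior edges; the sign function that keeps the minimal matching is the
negative of the old one. -/
def rev (w : List Bool) : List Bool := (w.reverse).map (fun a => !a)

namespace Snake

/-- The number of tiles. -/
def numTiles : Snake → ℕ
  | edge => 0
  | tiles w => w.length + 1

/-- The same snake graph, read in the opposite direction. -/
def op : Snake → Snake
  | edge => edge
  | tiles w => tiles (rev w)

/-- `dropPredWord s w` is `G ∖ pred(e)`, where `G` is the snake graph with word `w` and `e` is the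
first edge of sign `s` among the interior edges of `G` and the two north-east edges of its last
tile: all tiles before `e` are removed.  If no interior edge has sign `s`, only the north-east
edge `e` remains. -/
def dropPredWord (s : Bool) : List Bool → Snake
  | [] => edge
  | a :: w => if a = s then tiles w else dropPredWord s w

/-- `G ∖ pred(e)`, with `e` the first edge of sign `s` in `Int(G) ∪ G^{NE}`. -/
def dropPred (s : Bool) : Snake → Snake
  | edge => edge
  | tiles w => dropPredWord s w

/-- `G ∖ succ(e)`, with `e` the last edge of sign `s` in `Int(G) ∪ _{SW}G`. -/
def dropSucc (s : Bool) (g : Snake) : Snake := (g.op.dropPred (!s)).op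

end Snake

/-- Snake graphs and band graphs.  `band w b` is the band graph `G^b` obtained from the snake graph
`G` with word `w` by identifying the edge of sign `b` at the south-west corner with the edge of
sign `b` at the north-east corner.  Its cyclic word of interior edges is `w ++ [b]`, and it has
`w.length + 1` tiles. -/
inductive SBGraph where
  | snake (g : Snake) : SBGraph
  | band (w : List Bool) (b : Bool) : SBGraph

/-- Elementary isomorphisms: reading a snake or band graph backwards, and cutting a band graph at
a different interior edge. -/
inductive Iso : SBGraph → SBGraph → Prop
  | snake_op (g : Snake) : Iso (.snake g) (.snake g.op)
  | band_rotate (c : Bool) (w : List Bool) (b : Bool) : Iso (.band (c :: w) b) (.band (w ++ [b]) c)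
  | band_op (w : List Bool) (b : Bool) : Iso (.band w b) (.band (rev w) (!b))

/-- Isomorphism classes of snake and band graphs. -/
def IsoClass : Type := Quot Iso

/-- The isomorphism class of a graph. -/
def cls (g : SBGraph) : IsoClass := Quot.mk _ g

/-! ### Triangulated surfaces and realisability -/

/-- A triangulated oriented surface with marked points, given by its triangles.  The sides of each
triangle are numbered `0, 1, 2` counterclockwise.  `glue` sends a side to the side it is identified
with (with the orientation reversed), or to itself if it is a boundary segment.  The arcs of the
triangulation are the classes of sides not fixed by `glue`.  Self-folded triangles are allowed. -/
structure TriangulatedSurface where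
  n : ℕ
  pos : 0 < n
  glue : Fin n × ZMod 3 → Fin n × ZMod 3
  glue_glue : ∀ p, glue (glue p) = p
  connected : ∀ t u : Fin n, Relation.ReflTransGen (fun a b => ∃ i, (glue (a, i)).1 = b) t u

namespace TriangulatedSurface

variable (S : TriangulatedSurface)

/-- A side of a triangle of the triangulation. -/
abbrev Side : Type := Fin S.n × ZMod 3

/-- The side through which a curve that has entered a triangle through the side `p` leaves it:
the next side counterclockwise for the sign `+`, the previous one for the sign `-`. -/
def exit (p : S.Side) (s : Bool) : S.Side := (p.1, p.2 + if s then 1 else 2)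

/-- Follow a curve which has entered a triangle through the side `p` and makes the turns listed in
the word, one in each triangle; the result is the side through which the triangle after the last
crossing is entered, and `none` if the curve runs into the boundary. -/
def walk : List Bool → S.Side → Option S.Side
  | [], p => some p
  | a :: w, p => if S.glue (S.exit p a) = S.exit p a then none else walk w (S.glue (S.exit p a))

/-- The graph is the snake graph of an arc or the band graph of a closed curve of the surface:
a single edge is an arc of the triangulation; a snake graph with `d` tiles is a curve crossing
`d` arcs, a band graph with `d` tiles is a closed curve crossing `d` arcs; the signs of the interior
edges say on which side of the curve the third side of the triangle between two crossings lies. -/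
def Realises : SBGraph → Prop
  | .snake .edge => ∃ q : S.Side, S.glue q ≠ q
  | .snake (.tiles w) => ∃ q : S.Side, S.glue q ≠ q ∧ S.walk w (S.glue q) ≠ none
  | .band w b => ∃ p : S.Side, S.walk (w ++ [b]) p = some p

/-- The corner `(t, i)` is the one opposite to the side `i` of `t`.  It lies on the sides `i + 1`
and `i + 2`; this is the next corner at the same marked point, across the side `i + 2`. -/
def nextCorner (c : S.Side) : S.Side :=
  ((S.glue (c.1, c.2 + 2)).1, (S.glue (c.1, c.2 + 2)).2 + 2)

/-- Every marked point lies on the boundary: turning around it, one meets a boundary segment. -/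
def NoPuncture : Prop :=
  ∀ c : S.Side, ∃ k : ℕ,
    S.glue (((S.nextCorner)^[k] c).1, ((S.nextCorner)^[k] c).2 + 2) =
      (((S.nextCorner)^[k] c).1, ((S.nextCorner)^[k] c).2 + 2)

end TriangulatedSurface

/-- A graph is geometric if it comes from a curve in a triangulated surface. -/
def Geometric (q : IsoClass) : Prop :=
  ∃ (g : SBGraph) (S : TriangulatedSurface), cls g = q ∧ S.Realises g

/-- A graph is unpunctured if it comes from a curve in a triangulated surface without punctures. -/
def Unpunctured (q : IsoClass) : Prop :=
  ∃ (g : SBGraph) (S : TriangulatedSurface), cls g = q ∧ S.NoPuncture ∧ S.Realises g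

/-! ### Resolutions

`Resolution A a B c b C` is the identity `A = y ^ a • B + c • y ^ b • C` given by the resolution of
a crossing overlap, a crossing self-overlap or a grafting.  Here `A`, `B`, `C` are the (unions of)
graphs `G_{12}`, `G_{34}`, `G_{56}`; the integer `c` is the sign, or the multiplicity, with which
`G_{56}` occurs in the resolution, and `c = 0` means that `G_{56}` is zero. -/

/-- The snake graph with word `w`. -/
abbrev sn (w : List Bool) : SBGraph := .snake (.tiles w)

/-- The single edge. -/
abbrev ed : SBGraph := .snake .edge

/-- `Y` is an initial segment of the periodic word `UUU…`. -/
def PeriodicPrefix (Y U : List Bool) : Prop := ∃ k : ℕ, Y <+: (List.replicate k U).flatten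

/-- The part of the second term in the resolution of two crossing snake graphs which lies beyond
the overlap: `q` and `r` are the words of the two graphs after the overlap, starting with the edge
at the end of the overlap.  If both graphs continue, the two rests are glued to each other; if only
one does, its rest is cut at the first edge having the sign of the edge at the end of the
overlap. -/
def endPiece : List Bool → List Bool → Snake
  | c :: q, _ :: r => .tiles (rev r ++ (!c) :: q)
  | c :: q, [] => .dropPred c (.tiles q)
  | [], c :: r => .dropPred c (.tiles r)
  | [], [] => .edge

/-- The number of tiles of the first rest which do not lie in `endPiece q r`. -/
def endLoss (q r : List Bool) : ℕ := if r = [] then q.length - (endPiece q r).numTiles else 0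

/-- The crossing condition for the common overlap of the two snake graphs with words `P ++ O ++ Q`
and `P' ++ O ++ Q'`: the signs at the two ends of the overlap. -/
def CrossingSigns (P Q P' Q' : List Bool) : Prop :=
  (∃ a ∈ P.getLast?, ∃ b ∈ Q.head?, a ≠ b) ∨
  (∃ a ∈ P'.getLast?, ∃ b ∈ Q'.head?, a ≠ b) ∨
  (P = [] ∧ Q' = [] ∧ ∃ a ∈ P'.getLast?, a ∈ Q.head?) ∨
  (Q = [] ∧ P' = [] ∧ ∃ a ∈ P.getLast?, a ∈ Q'.head?)

/-- Resolutions of crossing overlaps of two graphs.  `O` is the word of the overlap, which has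
`O.length + 1` tiles. -/
inductive CrossingResolution :
    Multiset SBGraph → ℕ → Multiset SBGraph → ℤ → ℕ → Multiset SBGraph → Prop
  -- two snake graphs
  | snake_snake (O P Q P' Q' : List Bool)
      (hl : ∀ a ∈ P.getLast?, a ∉ P'.getLast?) (hr : ∀ a ∈ Q.head?, a ∉ Q'.head?)
      (hc : CrossingSigns P Q P' Q') :
      CrossingResolution {sn (P ++ O ++ Q), sn (P' ++ O ++ Q')} 0
        {sn (P ++ O ++ Q'), sn (P' ++ O ++ Q)} 1
        (O.length + 1 +
          if true ∈ P.getLast? ∨ false ∈ P'.getLast?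
          then endLoss (rev P) (rev P') + endLoss Q Q'
          else endLoss (rev P') (rev P) + endLoss Q' Q)
        {.snake (endPiece (rev P) (rev P')), .snake (endPiece Q Q')}
  -- a snake graph and a band graph, the overlap is not the whole band graph
  | snake_band (O V p q : List Bool) (c : Bool) :
      CrossingResolution
        {sn (p ++ [c] ++ O ++ (!c) :: q), .band (O ++ c :: V) (!c)} 0
        {sn (p ++ [c] ++ O ++ c :: V ++ (!c) :: O ++ (!c) :: q)} 1 (O.length + 1)
        {sn (p ++ (!c) :: rev V ++ c :: q)}
  | snake_band_left (O V q : List Bool) (c : Bool) :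
      CrossingResolution
        {sn (O ++ (!c) :: q), .band (O ++ c :: V) (!c)} 0
        {sn (O ++ c :: V ++ (!c) :: O ++ (!c) :: q)} 1
        (O.length + 1 + if c then 0 else
          (Snake.tiles (rev V ++ c :: q)).numTiles -
            (Snake.dropPred c (.tiles (rev V ++ c :: q))).numTiles)
        {.snake (.dropPred c (.tiles (rev V ++ c :: q)))}
  | snake_band_right (O V p : List Bool) (c : Bool) :
      CrossingResolution
        {sn (p ++ [c] ++ O), .band (O ++ c :: V) (!c)} 0
        {sn (p ++ [c] ++ O ++ c :: V ++ (!c) :: O)} 1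
        (O.length + 1 + if c then 0 else
          (Snake.tiles (p ++ (!c) :: rev V)).numTiles -
            (Snake.dropSucc (!c) (.tiles (p ++ (!c) :: rev V))).numTiles)
        {.snake (.dropSucc (!c) (.tiles (p ++ (!c) :: rev V)))}
  | snake_band_both (O V : List Bool) (c : Bool) :
      CrossingResolution
        {sn O, .band (O ++ c :: V) (!c)} 0
        {sn (O ++ c :: V ++ (!c) :: O)} 1
        (O.length + 1 + if c then 0 else
          (Snake.tiles (rev V)).numTiles -
            (Snake.dropSucc (!c) (.dropPred c (.tiles (rev V)))).numTiles)
        {.snake (.dropSucc (!c) (.dropPred c (.tiles (rev V))))}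
  -- a snake graph and a band graph `U ^ c`, the overlap (of word `U ++ [c] ++ Y` here) is at least
  -- the whole band graph
  | snake_band_whole (U Y P q : List Bool) (c : Bool)
      (hl : ∀ a ∈ P.getLast?, a = !c) (hY : PeriodicPrefix (Y ++ [!c]) (U ++ [c])) :
      CrossingResolution
        {sn (P ++ U ++ c :: Y ++ c :: q), .band U c} 0
        {sn (P ++ U ++ c :: U ++ c :: Y ++ c :: q)} 1 (U.length + 1)
        {sn (P ++ Y ++ c :: q)}
  -- two band graphs, the overlap is strictly smaller than both
  | band_band (O V V' : List Bool) (c : Bool) :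
      CrossingResolution
        {.band (O ++ c :: V) (!c), .band (O ++ (!c) :: V') c} 0
        {.band (O ++ c :: V ++ (!c) :: O ++ (!c) :: V') c} 1 (O.length + 1)
        {.band (V ++ c :: rev V') (!c)}
  -- two band graphs, the overlap is at least the whole of the second one
  | band_band_whole (U Y Z : List Bool) (c : Bool)
      (hY : PeriodicPrefix (Y ++ [!c]) (U ++ [c])) :
      CrossingResolution
        {.band (U ++ c :: Y ++ c :: Z) (!c), .band U c} 0
        {.band (U ++ c :: Y ++ c :: Z ++ (!c) :: U) c} 1 (U.length + 1)
        {.band (Y ++ c :: Z) (!c)}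

/-- Resolutions of crossing self-overlaps of a snake graph.  `O` is the word of the overlap, with
two embeddings `[s, t]`, `[s', t']`, `s < s'`; the two edges `e_t` and `e_{s' - 1}` have the same
sign `c`, and the edges `e_{s - 1}` and `e_{t'}`, if they exist, have sign `!c`. -/
inductive SnakeSelfResolution :
    Multiset SBGraph → ℕ → Multiset SBGraph → ℤ → ℕ → Multiset SBGraph → Prop
  -- same direction, `s' ≤ t`: the overlap has word `U ++ [c] ++ Y`, where `U ++ [c]` is the segment
  -- of signs from `e_s` to `e_{s' - 1}`
  | overlapping (U Y P Q : List Bool) (c : Bool)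
      (hl : ∀ a ∈ P.getLast?, a = !c) (hr : ∀ a ∈ Q.head?, a = !c)
      (hY : PeriodicPrefix (Y ++ [c]) (U ++ [c])) :
      SnakeSelfResolution {sn (P ++ U ++ c :: U ++ c :: Y ++ Q)} 0
        {sn (P ++ U ++ c :: Y ++ Q), .band U c} (-1) (U.length + 1) {sn (P ++ Y ++ Q)}
  -- same direction, `s' > t + 1`
  | apart (O V p q : List Bool) (c : Bool) :
      SnakeSelfResolution {sn (p ++ (!c) :: O ++ c :: V ++ c :: O ++ (!c) :: q)} 0
        {sn (p ++ (!c) :: O ++ (!c) :: q), .band (O ++ c :: V) c} 1 (O.length + 1)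
        {sn (p ++ c :: rev V ++ c :: q)}
  | apart_right (O V p : List Bool) (c : Bool) :
      SnakeSelfResolution {sn (p ++ (!c) :: O ++ c :: V ++ c :: O)} 0
        {sn (p ++ (!c) :: O), .band (O ++ c :: V) c} 1
        (O.length + 1 + if c then 0 else
          (Snake.tiles (p ++ c :: rev V)).numTiles -
            (Snake.dropSucc (!c) (.tiles (p ++ c :: rev V))).numTiles)
        {.snake (.dropSucc (!c) (.tiles (p ++ c :: rev V)))}
  | apart_left (O V q : List Bool) (c : Bool) :
      SnakeSelfResolution {sn (O ++ c :: V ++ c :: O ++ (!c) :: q)} 0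
        {sn (O ++ (!c) :: q), .band (O ++ c :: V) c} 1
        (O.length + 1 + if c then
          (Snake.tiles (rev V ++ c :: q)).numTiles -
            (Snake.dropPred (!c) (.tiles (rev V ++ c :: q))).numTiles else 0)
        {.snake (.dropPred (!c) (.tiles (rev V ++ c :: q)))}
  -- both ends of the snake graph belong to the overlap: the remaining part is cut at the first and
  -- at the last edge of sign `!c`
  | apart_both (O V A M B : List Bool) (c : Bool)
      (hV : rev V = A ++ (!c) :: M ++ (!c) :: B) (hA : (!c) ∉ A) (hB : (!c) ∉ B) :
      SnakeSelfResolution {sn (O ++ c :: V ++ c :: O)} 0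
        {sn O, .band (O ++ c :: V) c} 1
        (O.length + 1 + if c then A.length + 1 else B.length + 1) {sn M}
  | apart_both_edge (O V A B : List Bool) (c : Bool)
      (hV : rev V = A ++ (!c) :: B) (hA : (!c) ∉ A) (hB : (!c) ∉ B) :
      SnakeSelfResolution {sn (O ++ c :: V ++ c :: O)} 0
        {sn O, .band (O ++ c :: V) c} 1
        (O.length + 1 + if c then A.length + 1 else B.length + 1) {ed}
  | apart_both_zero (O V : List Bool) (c : Bool) (hV : (!c) ∉ rev V) :
      SnakeSelfResolution {sn (O ++ c :: V ++ c :: O)} 0 {sn O, .band (O ++ c :: V) c} 0 0 0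
  -- same direction, `s' = t + 1`: the two rests are compared along the secondary overlap `A` in the
  -- opposite direction; `g` is the sign of the first pair of edges at which they differ
  | adjacent (O A p q : List Bool) (c g : Bool) :
      SnakeSelfResolution
        {sn (p ++ g :: rev A ++ (!c) :: O ++ c :: O ++ (!c) :: A ++ g :: q)} 0
        {sn (p ++ g :: rev A ++ (!c) :: O ++ (!c) :: A ++ g :: q), .band O c}
        (if g = c then -1 else 1) (O.length + 1 + A.length + 1) {sn (p ++ (!g) :: q)}
  | adjacent_left (O A q : List Bool) (c g : Bool) :
      SnakeSelfResolution {sn (rev A ++ (!c) :: O ++ c :: O ++ (!c) :: A ++ g :: q)} 0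
        {sn (rev A ++ (!c) :: O ++ (!c) :: A ++ g :: q), .band O c}
        (if g = c then -1 else 1)
        (O.length + 1 + A.length + 1 + if g then 0 else
          (Snake.tiles q).numTiles - (Snake.dropPred g (.tiles q)).numTiles)
        {.snake (.dropPred g (.tiles q))}
  | adjacent_right (O A p : List Bool) (c g : Bool) :
      SnakeSelfResolution {sn (p ++ g :: rev A ++ (!c) :: O ++ c :: O ++ (!c) :: A)} 0
        {sn (p ++ g :: rev A ++ (!c) :: O ++ (!c) :: A), .band O c}
        (if g = c then -1 else 1)
        (O.length + 1 + A.length + 1 + if g then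
          (Snake.tiles p).numTiles - (Snake.dropSucc g (.tiles p)).numTiles else 0)
        {.snake (.dropSucc g (.tiles p))}
  | adjacent_zero (O A : List Bool) (c : Bool) :
      SnakeSelfResolution {sn (rev A ++ (!c) :: O ++ c :: O ++ (!c) :: A)} 0
        {sn (rev A ++ (!c) :: O ++ (!c) :: A), .band O c} 0 0 0
  | adjacent_start (O q : List Bool) (c : Bool) :
      SnakeSelfResolution {sn (O ++ c :: O ++ (!c) :: q)} 0
        {sn (O ++ (!c) :: q), .band O c} (-1)
        (O.length + 1 + if c then 0 else
          (Snake.tiles q).numTiles - (Snake.dropPred c (.tiles q)).numTiles)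
        {.snake (.dropPred c (.tiles q))}
  | adjacent_end (O p : List Bool) (c : Bool) :
      SnakeSelfResolution {sn (p ++ (!c) :: O ++ c :: O)} 0
        {sn (p ++ (!c) :: O), .band O c} (-1)
        (O.length + 1 + if c then
          (Snake.tiles p).numTiles - (Snake.dropSucc c (.tiles p)).numTiles else 0)
        {.snake (.dropSucc c (.tiles p))}
  | adjacent_both (O : List Bool) (c : Bool) :
      SnakeSelfResolution {sn (O ++ c :: O)} 0 {sn O, .band O c} (-1) (O.length + 1) {ed}
  -- opposite direction
  | opposite (O V p q : List Bool) (c : Bool) :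
      SnakeSelfResolution {sn (p ++ (!c) :: O ++ c :: V ++ c :: rev O ++ (!c) :: q)} 0
        {sn (p ++ (!c) :: O ++ (!c) :: rev V ++ (!c) :: rev O ++ (!c) :: q)} 1 (O.length + 1)
        {sn (p ++ c :: q), .band V (!c)}
  | opposite_left (O V q : List Bool) (c : Bool) :
      SnakeSelfResolution {sn (O ++ c :: V ++ c :: rev O ++ (!c) :: q)} 0
        {sn (O ++ (!c) :: rev V ++ (!c) :: rev O ++ (!c) :: q)} 1
        (O.length + 1 + if c then
          (Snake.tiles q).numTiles - (Snake.dropPred (!c) (.tiles q)).numTiles else 0)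
        {.snake (.dropPred (!c) (.tiles q)), .band V (!c)}
  | opposite_right (O V p : List Bool) (c : Bool) :
      SnakeSelfResolution {sn (p ++ (!c) :: O ++ c :: V ++ c :: rev O)} 0
        {sn (p ++ (!c) :: O ++ (!c) :: rev V ++ (!c) :: rev O)} 1
        (O.length + 1 + if c then 0 else
          (Snake.tiles p).numTiles - (Snake.dropSucc (!c) (.tiles p)).numTiles)
        {.snake (.dropSucc (!c) (.tiles p)), .band V (!c)}

/-- Resolutions of crossing self-overlaps of a band graph, cut such that the first embedding of the
overlap starts with the first tile. -/
inductive BandSelfResolution :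
    Multiset SBGraph → ℕ → Multiset SBGraph → ℤ → ℕ → Multiset SBGraph → Prop
  -- same direction, `s' ≤ t`, the overlap is not the whole band graph
  | overlapping (U Y Q : List Bool) (c : Bool) (hr : ∀ a ∈ Q.head?, a = !c)
      (hY : PeriodicPrefix (Y ++ [c]) (U ++ [c])) :
      BandSelfResolution {.band (U ++ c :: U ++ c :: Y ++ Q) (!c)} 0
        {.band (U ++ c :: Y ++ Q) (!c), .band U c} (-1) (U.length + 1) {.band (Y ++ Q) (!c)}
  -- the overlap is the whole band graph
  | whole (U Y : List Bool) (c : Bool) (h : U ++ c :: Y = Y ++ c :: U) :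
      BandSelfResolution {.band (U ++ c :: U ++ c :: Y) c} 0
        {.band (U ++ c :: Y) c, .band U c} (-1) (U.length + 1) {.band Y c}
  | double (U : List Bool) (c : Bool) :
      BandSelfResolution {.band (U ++ c :: U) c} 0
        {.band U c, .band U c} (-2) (U.length + 1) 0
  -- same direction, `s' > t + 1`
  | apart (O V W : List Bool) (c : Bool) :
      BandSelfResolution {.band (O ++ c :: V ++ c :: O ++ (!c) :: W) (!c)} 0
        {.band (O ++ (!c) :: W) (!c), .band (O ++ c :: V) c} 1 (O.length + 1)
        {.band (rev V ++ c :: W) c}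
  -- same direction, `s' = t + 1`
  | adjacent_both (O : List Bool) (c : Bool) :
      BandSelfResolution {.band (O ++ c :: O) (!c)} 0
        {.band O (!c), .band O c} (-1) (O.length + 1) 0
  | adjacent (O A M : List Bool) (c g : Bool) :
      BandSelfResolution
        {.band (O ++ c :: O ++ (!c) :: A ++ g :: M ++ g :: rev A) (!c)} 0
        {.band (O ++ (!c) :: A ++ g :: M ++ g :: rev A) (!c), .band O c}
        (if g = c then -1 else 1) (O.length + 1 + A.length + 1) {.band M (!g)}
  | adjacent_empty (O A : List Bool) (c g : Bool) :
      BandSelfResolution {.band (O ++ c :: O ++ (!c) :: A ++ g :: rev A) (!c)} 0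
        {.band (O ++ (!c) :: A ++ g :: rev A) (!c), .band O c}
        (if g = c then -1 else 1) (O.length + 1 + A.length + 1) 0
  | adjacent_zero (O A : List Bool) (c : Bool) :
      BandSelfResolution {.band (O ++ c :: O ++ (!c) :: A ++ rev A) (!c)} 0
        {.band (O ++ (!c) :: A ++ rev A) (!c), .band O c} 0 0 0
  -- opposite direction
  | opposite (O V W : List Bool) (c : Bool) :
      BandSelfResolution {.band (O ++ c :: V ++ c :: rev O ++ (!c) :: W) (!c)} 0
        {.band (O ++ (!c) :: rev V ++ (!c) :: rev O ++ (!c) :: W) (!c)} 1 (O.length + 1)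
        {.band W c, .band V (!c)}

/-- Resolutions of graftings. -/
inductive GraftingResolution :
    Multiset SBGraph → ℕ → Multiset SBGraph → ℤ → ℕ → Multiset SBGraph → Prop
  -- a snake graph grafted on the tile `G_s` of another one, `0 < s < d`; `e = e_s`
  | snake_snake (L R H : List Bool) (e : Bool) :
      GraftingResolution {sn (L ++ e :: R), sn H}
        (if e then (Snake.tiles R).numTiles - (Snake.dropPred (!e) (.tiles R)).numTiles else 0)
        {sn (L ++ (!e) :: H), .snake (.dropPred (!e) (.tiles R))} 1
        (if e then 0 else (Snake.tiles L).numTiles - (Snake.dropSucc (!e) (.tiles L)).numTiles)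
        {.snake (.dropSucc (!e) (.tiles L)), sn (rev H ++ (!e) :: R)}
  -- a snake graph grafted on the last tile of another one, along an edge of sign `e`
  | snake_snake_end (L H : List Bool) (e : Bool) :
      GraftingResolution {sn L, sn H} 0 {sn (L ++ e :: H), ed} 1
        (if e then (Snake.tiles L).numTiles - (Snake.dropSucc e (.tiles L)).numTiles
          else (Snake.tiles H).numTiles - (Snake.dropPred e (.tiles H)).numTiles)
        {.snake (.dropSucc e (.tiles L)), .snake (.dropPred e (.tiles H))}
  -- a single edge which is the diagonal of the tile between the words `L` and `R`
  | snake_edge (L R : List Bool) :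
      GraftingResolution {sn (L ++ R), ed} 0
        {.snake (.dropSucc false (.tiles L)), .snake (.dropPred true (.tiles R))} 1
        ((Snake.tiles (L ++ R)).numTiles -
          ((Snake.dropSucc true (.tiles L)).numTiles + (Snake.dropPred false (.tiles R)).numTiles))
        {.snake (.dropSucc true (.tiles L)), .snake (.dropPred false (.tiles R))}
  -- self-grafting of a snake graph in the tile `G_s`, `s < d`; `e = e_s`
  | self (L R : List Bool) (e : Bool) :
      GraftingResolution {sn (L ++ e :: R)}
        (if e then (Snake.tiles R).numTiles - (Snake.dropPred (!e) (.tiles R)).numTiles else 0)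
        {.snake (.dropPred (!e) (.tiles R)), .band L (!e)} 1
        (if e then 0 else (Snake.tiles (L ++ e :: R)).numTiles -
          (Snake.dropPred e (.tiles (rev L ++ (!e) :: R))).numTiles)
        {.snake (.dropPred e (.tiles (rev L ++ (!e) :: R)))}
  -- self-grafting of a snake graph in its last tile, along an edge of sign `b`; the second term is
  -- what remains between the first and the last interior edge of sign `b`
  | self_end (A M B : List Bool) (b : Bool) (hA : b ∉ A) (hB : b ∉ B) :
      GraftingResolution {sn (A ++ b :: M ++ b :: B)} 0
        {.band (A ++ b :: M ++ b :: B) b, ed} 1 (if b then B.length + 1 else A.length + 1) {sn M}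
  | self_end_edge (A B : List Bool) (b : Bool) (hA : b ∉ A) (hB : b ∉ B) :
      GraftingResolution {sn (A ++ b :: B)} 0
        {.band (A ++ b :: B) b, ed} 1 (if b then B.length + 1 else A.length + 1) {ed}
  | self_end_zero (w : List Bool) (b : Bool) (hw : b ∉ w) :
      GraftingResolution {sn w} 0 {.band w b, ed} 0 0 0
  -- a band graph grafted on the last tile of a snake graph
  | snake_band (L H : List Bool) (b : Bool) :
      GraftingResolution {sn L, .band H b}
        (if b then 0 else (Snake.tiles (L ++ (!b) :: H)).numTiles -
          (Snake.dropSucc (!b) (.tiles (L ++ (!b) :: H))).numTiles)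
        {.snake (.dropSucc (!b) (.tiles (L ++ (!b) :: H)))} 1
        (if b then (Snake.tiles (L ++ b :: rev H)).numTiles -
          (Snake.dropSucc b (.tiles (L ++ b :: rev H))).numTiles else 0)
        {.snake (.dropSucc b (.tiles (L ++ b :: rev H)))}
  -- a band graph and a single edge
  | edge_band (H : List Bool) (b : Bool) :
      GraftingResolution {ed, .band H b}
        (if b then (Snake.tiles H).numTiles - (Snake.dropPred (!b) (.tiles H)).numTiles else 0)
        {.snake (.dropPred (!b) (.tiles H))} 1
        (if b then 0 else (Snake.tiles H).numTiles -
          (Snake.dropPred b (.dropSucc (!b) (.tiles H))).numTiles)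
        {.snake (.dropPred b (.dropSucc (!b) (.tiles H)))}

/-- All resolutions. -/
def Resolution (A : Multiset SBGraph) (a : ℕ) (B : Multiset SBGraph) (c : ℤ) (b : ℕ)
    (C : Multiset SBGraph) : Prop :=
  CrossingResolution A a B c b C ∨ SnakeSelfResolution A a B c b C ∨
    BandSelfResolution A a B c b C ∨ GraftingResolution A a B c b C

/-! ### The rings -/

/-- The free `ℤ[y]`-module on the finite unions of graphs of type `P` (all edges are labeled `x` and
all faces `y`), with the disjoint union as multiplication, that is, the polynomial ring over `ℤ[y]`
in the isomorphism classes of single snake and band graphs of type `P`. -/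
abbrev XYR (P : IsoClass → Prop) : Type := MvPolynomial {q : IsoClass // P q} ℤ[X]

noncomputable section

/-- The basis element given by a finite union of graphs. -/
def XYR.union {P : IsoClass → Prop} (A : Multiset {q : IsoClass // P q}) : XYR P :=
  (A.map MvPolynomial.X).prod

/-- The ideal of resolutions: it is generated by all resolutions whose terms lie in the ring. -/
def resolutionIdeal (P : IsoClass → Prop) : Ideal (XYR P) :=
  Ideal.span {z | ∃ (A B C : Multiset {q : IsoClass // P q}) (A' B' C' : Multiset SBGraph)
    (a b : ℕ) (c : ℤ), Resolution A' a B' c b C' ∧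
      A.map Subtype.val = A'.map cls ∧ B.map Subtype.val = B'.map cls ∧
      C.map Subtype.val = C'.map cls ∧
      z = XYR.union A - ((Polynomial.X : ℤ[X]) ^ a • XYR.union B +
        (c • (Polynomial.X : ℤ[X]) ^ b) • XYR.union C)}

/-- The quotient by the ideal of resolutions. -/
abbrev XYQuotient (P : IsoClass → Prop) : Type := XYR P ⧸ resolutionIdeal P

/-- The elements of the quotient given by the graphs of type `P` in a set of graphs. -/
def generators (P : IsoClass → Prop) (s : Set SBGraph) : Set (XYQuotient P) :=
  {z | ∃ (g : SBGraph) (h : P (cls g)), g ∈ s ∧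
    z = Ideal.Quotient.mk (resolutionIdeal P) (MvPolynomial.X ⟨cls g, h⟩)}

/-- The unpunctured ring. -/
abbrev XYS : Type := XYQuotient Unpunctured

/-- The geometric ring. -/
abbrev XYSgeo : Type := XYQuotient Geometric

end

end SnakeCalc

open scoped Fin.CommRing

namespace SnakeCalc

/-! ### The annulus of a cyclic word -/

/-! Both parts are inductions on the number of tiles. Each rewrites one graph, modulo a single
resolution, as a polynomial in graphs that are smaller or already generated.

Snake graphs (`snake_mem`): self-grafting in the last tile along an edge of sign `b` turns a snake
graph into a band graph times the single edge, plus a power of `y` times a shorter snake graph, the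
single edge or zero. If `b` is opposite to the first letter of the word, the cyclic word of the band
graph contains both signs, so the step stays inside the unpunctured ring. This proves (a).

Band graphs (`band_mem`): a cyclic word with at least two letters has a crossing self-overlap whose
resolution involves only shorter band graphs. If it contains a run of at least two equal signs and
also the other sign, a one-tile band graph splits off at the start of the run. A constant or
alternating word is a power of a shorter cyclic word, one copy of which splits off, except for the
two-letter alternating word, which splits into two one-tile band graphs. In the geometric ring the
single tile also equals the one-tile band graph times the single edge, so (b) follows from
`snake_mem` and `band_mem`.

A resolution counts only if all its terms lie in the ring, so surfaces are needed. A cyclic word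
glues triangles into a ring whose core curve has that word. A marked point there avoids the boundary
only if all turns agree (`annulus_noPuncture`). Every snake word extends to a cyclic word with both
signs, so every snake graph is unpunctured. -/

/-- The side through which a curve that has entered a triangle through its side `0` leaves it. -/
def exitSide (s : Bool) : ZMod 3 := if s then 1 else 2

/-- The gluing of the triangles `0, …, m` to an annulus: the exit side of each triangle is glued to
the side `0` of the next one. -/
def annulusGlue {m : ℕ} (u : Fin (m + 1) → Bool) (p : Fin (m + 1) × ZMod 3) :
    Fin (m + 1) × ZMod 3 :=
  if p.2 = 0 then (p.1 - 1, exitSide (u (p.1 - 1)))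
  else if p.2 = exitSide (u p.1) then (p.1 + 1, 0) else p

theorem exitSide_ne_zero (s : Bool) : exitSide s ≠ 0 := by cases s <;> decide

theorem annulusGlue_zero {m : ℕ} (u : Fin (m + 1) → Bool) (i : Fin (m + 1)) :
    annulusGlue u (i, 0) = (i - 1, exitSide (u (i - 1))) := by
  simp [annulusGlue]

theorem annulusGlue_exit {m : ℕ} (u : Fin (m + 1) → Bool) (i : Fin (m + 1)) :
    annulusGlue u (i, exitSide (u i)) = (i + 1, 0) := by
  simp [annulusGlue, exitSide_ne_zero]

theorem annulusGlue_boundary {m : ℕ} (u : Fin (m + 1) → Bool) (i : Fin (m + 1)) (j : ZMod 3)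
    (h0 : j ≠ 0) (h1 : j ≠ exitSide (u i)) : annulusGlue u (i, j) = (i, j) := by
  simp [annulusGlue, h0, h1]

/-- The triangulated annulus (or punctured disc) whose core curve makes the turns `u`. -/
abbrev annulus {m : ℕ} (u : Fin (m + 1) → Bool) : TriangulatedSurface where
  n := m + 1
  pos := Nat.succ_pos m
  glue := annulusGlue u
  glue_glue := by
    rintro ⟨i, j⟩
    by_cases h0 : j = 0
    · subst h0
      rw [annulusGlue_zero, annulusGlue_exit, sub_add_cancel]
    by_cases h1 : j = exitSide (u i)
    · subst h1
      rw [annulusGlue_exit, annulusGlue_zero, add_sub_cancel_right]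
    · rw [annulusGlue_boundary u i j h0 h1, annulusGlue_boundary u i j h0 h1]
  connected := by
    intro t v
    have key : ∀ k : ℕ, Relation.ReflTransGen
        (fun a b => ∃ i, (annulusGlue u (a, i)).1 = b) t (t + (k : Fin (m + 1))) := by
      intro k
      induction k with
      | zero => simpa using Relation.ReflTransGen.refl
      | succ k ih =>
        refine ih.tail ⟨exitSide (u (t + (k : Fin (m + 1)))), ?_⟩
        rw [annulusGlue_exit]
        push_cast
        ring
    have := key (v - t).val
    rwa [Fin.cast_val_eq_self, add_sub_cancel] at this

theorem annulus_walk {m : ℕ} (u : Fin (m + 1) → Bool) (l : List Bool) (i : Fin (m + 1))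
    (h : ∀ (k : ℕ) (hk : k < l.length), l[k] = u (i + (k : Fin (m + 1)))) :
    (annulus u).walk l (i, 0) = some (i + (l.length : Fin (m + 1)), 0) := by
  induction l generalizing i with
  | nil =>
    rw [List.length_nil, Nat.cast_zero, add_zero]
    rfl
  | cons a l ih =>
    have ha : a = u i := by
      have := h 0 (Nat.succ_pos _)
      rwa [Nat.cast_zero, add_zero] at this
    have he : (annulus u).exit (i, 0) a = (i, exitSide (u i)) := by
      rw [TriangulatedSurface.exit, ha, zero_add]
      rfl
    have hg : (annulus u).glue (i, exitSide (u i)) = (i + 1, 0) := annulusGlue_exit u i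
    rw [TriangulatedSurface.walk, he, hg, if_neg, ih]
    · simp only [List.length_cons, Nat.cast_add, Nat.cast_one]
      congr 2
      ring
    · intro k hk
      have := h (k + 1) (by simpa using hk)
      rw [List.getElem_cons_succ] at this
      rw [this]
      congr 1
      push_cast
      ring
    · intro hh
      exact exitSide_ne_zero _ (congrArg Prod.snd hh).symm

/-! ### Turning around the marked points of the annulus -/

/-- Turning around the marked point at the corner `c`, one meets a boundary segment. -/
def ReachesBoundary (S : TriangulatedSurface) (c : S.Side) : Prop :=
  ∃ k : ℕ, S.glue (((S.nextCorner)^[k] c).1, ((S.nextCorner)^[k] c).2 + 2) =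
    (((S.nextCorner)^[k] c).1, ((S.nextCorner)^[k] c).2 + 2)

theorem reachesBoundary_of_glue {S : TriangulatedSurface} {c d : S.Side}
    (h : S.glue (c.1, c.2 + 2) = d) (hd : ReachesBoundary S (d.1, d.2 + 2)) :
    ReachesBoundary S c := by
  obtain ⟨k, hk⟩ := hd
  refine ⟨k + 1, ?_⟩
  have hn : S.nextCorner c = (d.1, d.2 + 2) := by rw [TriangulatedSurface.nextCorner, h]
  simpa only [Function.iterate_succ_apply, hn] using hk

theorem annulus_reachesBoundary_of_fixed {m : ℕ} (u : Fin (m + 1) → Bool) (i : Fin (m + 1))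
    (j : ZMod 3) (h0 : j + 2 ≠ 0) (h1 : j + 2 ≠ exitSide (u i)) :
    ReachesBoundary (annulus u) (i, j) :=
  ⟨0, annulusGlue_boundary u i _ h0 h1⟩

theorem annulus_reachesBoundary_of_exit {m : ℕ} (u : Fin (m + 1) → Bool) (i : Fin (m + 1))
    (j : ZMod 3) (h : j + 2 = exitSide (u i)) (hn : ReachesBoundary (annulus u) ((i + 1 : Fin (m + 1)), 2)) :
    ReachesBoundary (annulus u) (i, j) := by
  refine reachesBoundary_of_glue (d := ((i + 1 : Fin (m + 1)), (0 : ZMod 3))) ?_ ?_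
  · change annulusGlue u (i, j + 2) = _
    rw [h, annulusGlue_exit]
  · simpa only [zero_add] using hn

theorem annulus_reachesBoundary_of_entry {m : ℕ} (u : Fin (m + 1) → Bool) (i : Fin (m + 1))
    (hn : ReachesBoundary (annulus u) ((i - 1 : Fin (m + 1)), exitSide (u (i - 1)) + 2)) :
    ReachesBoundary (annulus u) (i, 1) :=
  reachesBoundary_of_glue (d := ((i - 1 : Fin (m + 1)), exitSide (u (i - 1)))) (annulusGlue_zero u i) hn

/-- The next side at corner `2` is side `1`. It is the exit after a turn `+`, leading to corner `2`
of the next triangle, and a boundary segment after a turn `-`. So the rotation moves forward until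
the first `-`. -/
theorem annulus_reachesBoundary_up {m : ℕ} (u : Fin (m + 1) → Bool) (n : ℕ) (i : Fin (m + 1))
    (hi : u (i + (n : Fin (m + 1))) = false) : ReachesBoundary (annulus u) (i, 2) := by
  induction n generalizing i with
  | zero =>
    simp only [Nat.cast_zero, add_zero] at hi
    exact annulus_reachesBoundary_of_fixed u i 2 (by decide) (by rw [hi]; decide)
  | succ n ih =>
    cases h : u i
    · exact annulus_reachesBoundary_of_fixed u i 2 (by decide) (by rw [h]; decide)
    · refine annulus_reachesBoundary_of_exit u i 2 (by rw [h]; decide) (ih _ ?_)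
      rw [← hi]
      congr 1
      push_cast
      ring

/-- The next side at corner `1` is the entry side `0`, so the rotation goes back one triangle. It
arrives at corner `1` again if the turn there is `-`, and next to a boundary segment if it is `+`.
-/
theorem annulus_reachesBoundary_down {m : ℕ} (u : Fin (m + 1) → Bool) (n : ℕ) (i : Fin (m + 1))
    (hi : u (i - 1 - (n : Fin (m + 1))) = true) : ReachesBoundary (annulus u) (i, 1) := by
  induction n generalizing i with
  | zero =>
    simp only [Nat.cast_zero, sub_zero] at hi
    apply annulus_reachesBoundary_of_entry
    rw [hi]
    exact annulus_reachesBoundary_of_fixed u _ _ (by decide) (by rw [hi]; decide)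
  | succ n ih =>
    apply annulus_reachesBoundary_of_entry
    cases h : u (i - 1)
    · refine ih _ ?_
      rw [← hi]
      congr 1
      push_cast
      ring
    · exact annulus_reachesBoundary_of_fixed u _ _ (by decide) (by rw [h]; decide)

/-- Each rotation either meets a boundary segment at once, or runs forward until a `-`, or runs
backward until a `+`. Cyclically, both signs are reached from anywhere. -/
theorem annulus_noPuncture {m : ℕ} (u : Fin (m + 1) → Bool)
    (ht : ∃ i, u i = true) (hf : ∃ i, u i = false) : (annulus u).NoPuncture := by
  obtain ⟨a, ha⟩ := ht
  obtain ⟨b, hb⟩ := hf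
  have key : ∀ (i : Fin (m + 1)) (j : ZMod 3), ReachesBoundary (annulus u) (i, j) := by
    intro i j
    by_cases h0 : j + 2 = 0
    · have hj : j = 1 := by revert h0; revert j; decide
      subst hj
      refine annulus_reachesBoundary_down u (i - 1 - a).val i ?_
      rw [Fin.cast_val_eq_self, sub_sub_cancel, ha]
    by_cases h1 : j + 2 = exitSide (u i)
    · refine annulus_reachesBoundary_of_exit u i j h1
        (annulus_reachesBoundary_up u (b - (i + 1)).val (i + 1) ?_)
      rw [Fin.cast_val_eq_self, add_sub_cancel, hb]
    · exact annulus_reachesBoundary_of_fixed u i j h0 h1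
  exact fun c => key c.1 c.2

/-! ### Realising band and snake graphs -/

/-- The surface on which the band graph with cyclic word `w ++ [b]` is realised. -/
def bandSurface (w : List Bool) (b : Bool) : TriangulatedSurface :=
  annulus (m := w.length) fun i => (w ++ [b])[i.val]'(i.isLt.trans_eq (by simp))

theorem bandSurface_realises (w : List Bool) (b : Bool) :
    (bandSurface w b).Realises (.band w b) := by
  refine ⟨((0 : Fin (w.length + 1)), 0), ?_⟩
  refine (annulus_walk _ _ _ ?_).trans ?_
  · intro k hk
    have hk' : k < w.length + 1 := by simpa using hk
    simp [Nat.mod_eq_of_lt hk']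
  · have : (((w ++ [b]).length : ℕ) : Fin (w.length + 1)) = 0 := by simp
    rw [this, add_zero]
    rfl

theorem bandSurface_noPuncture (w : List Bool) (b : Bool) (h : (!b) ∈ w) :
    (bandSurface w b).NoPuncture := by
  have hb : ∃ i : Fin (w.length + 1), (w ++ [b])[i.val]'(i.isLt.trans_eq (by simp)) = b :=
    ⟨Fin.last _, by simp⟩
  have hn : ∃ i : Fin (w.length + 1), (w ++ [b])[i.val]'(i.isLt.trans_eq (by simp)) = !b := by
    obtain ⟨k, hk, hw⟩ := List.getElem_of_mem h
    exact ⟨⟨k, by omega⟩, by simp [hk, hw]⟩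
  cases b
  · exact annulus_noPuncture _ hn hb
  · exact annulus_noPuncture _ hb hn

theorem walk_append (S : TriangulatedSurface) (v w : List Bool) (p : S.Side) :
    S.walk (v ++ w) p = (S.walk v p).bind (S.walk w) := by
  induction v generalizing p with
  | nil => rfl
  | cons a v ih =>
    simp only [List.cons_append, TriangulatedSurface.walk]
    split
    · rfl
    · exact ih _

theorem glue_ne_of_walk (S : TriangulatedSurface) (w : List Bool) (p q : S.Side)
    (hw : w ≠ []) (h : S.walk w p = some q) : S.glue q ≠ q := by
  induction w generalizing p with
  | nil => exact absurd rfl hw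
  | cons a w ih =>
    simp only [TriangulatedSurface.walk] at h
    split at h
    · simp at h
    · next hne =>
      by_cases hw' : w = []
      · subst hw'
        simp only [TriangulatedSurface.walk, Option.some.injEq] at h
        rw [← h, S.glue_glue]
        exact fun hh => hne hh.symm
      · exact ih _ hw' h

theorem geometric_band (w : List Bool) (b : Bool) : Geometric (cls (.band w b)) :=
  ⟨_, bandSurface w b, rfl, bandSurface_realises w b⟩

theorem unpunctured_band (w : List Bool) (b : Bool) (h : (!b) ∈ w) :
    Unpunctured (cls (.band w b)) :=
  ⟨_, bandSurface w b, rfl, bandSurface_noPuncture w b h, bandSurface_realises w b⟩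

/-- Appending `+` and `-` to the word gives a cyclic word with both signs. Its core curve runs in a
surface without punctures, and the snake graph comes from an initial piece of that curve. -/
theorem unpunctured_snake (g : Snake) : Unpunctured (cls (.snake g)) := by
  cases g with
  | edge =>
    obtain ⟨p, hp⟩ := bandSurface_realises [true] false
    exact ⟨_, _, rfl, bandSurface_noPuncture [true] false (by simp), p,
      glue_ne_of_walk _ _ _ _ (by simp) hp⟩
  | tiles w =>
    obtain ⟨p, hp⟩ := bandSurface_realises (w ++ [true]) false
    refine ⟨_, _, rfl, bandSurface_noPuncture (w ++ [true]) false (by simp),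
      (bandSurface (w ++ [true]) false).glue p, ?_, ?_⟩
    · rw [TriangulatedSurface.glue_glue]
      exact (glue_ne_of_walk _ _ _ _ (by simp) hp).symm
    · rw [TriangulatedSurface.glue_glue]
      intro h
      rw [List.append_assoc, walk_append, h] at hp
      simp at hp

theorem geometric_snake (g : Snake) : Geometric (cls (.snake g)) :=
  let ⟨g', S, h, _, hr⟩ := unpunctured_snake g
  ⟨g', S, h, hr⟩

/-! ### Resolutions in the quotient -/

noncomputable section

open Classical in
/-- The element of the quotient given by a graph, which is zero if the graph is not of type `P`. -/
def graphElem (P : IsoClass → Prop) (g : SBGraph) : XYQuotient P :=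
  if h : P (cls g) then Ideal.Quotient.mk (resolutionIdeal P) (MvPolynomial.X ⟨cls g, h⟩) else 0

theorem graphElem_of {P : IsoClass → Prop} {g : SBGraph} (h : P (cls g)) :
    graphElem P g = Ideal.Quotient.mk (resolutionIdeal P) (MvPolynomial.X ⟨cls g, h⟩) :=
  dif_pos h

theorem graphElem_congr {P : IsoClass → Prop} {g g' : SBGraph} (h : cls g = cls g') :
    graphElem P g = graphElem P g' := by
  unfold graphElem
  by_cases hP : P (cls g)
  · rw [dif_pos hP, dif_pos (h ▸ hP)]
    simp only [h]
  · rw [dif_neg hP, dif_neg (h ▸ hP)]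

theorem mk_union_pmap {P : IsoClass → Prop} (A : Multiset SBGraph) (hA : ∀ g ∈ A, P (cls g)) :
    Ideal.Quotient.mk (resolutionIdeal P)
      (XYR.union (A.pmap (fun g h => (⟨cls g, h⟩ : {q : IsoClass // P q})) hA)) =
      (A.map (graphElem P)).prod := by
  rw [XYR.union, map_multiset_prod, Multiset.map_map, Multiset.map_pmap, ← Multiset.pmap_eq_map
    (fun g => P (cls g)) (graphElem P) A hA]
  congr 1
  exact Multiset.pmap_congr A fun g _ h _ => (graphElem_of h).symm

theorem graphElem_resolution {P : IsoClass → Prop} {A B C : Multiset SBGraph} {a b : ℕ} {c : ℤ}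
    (h : Resolution A a B c b C) (hA : ∀ g ∈ A, P (cls g)) (hB : ∀ g ∈ B, P (cls g))
    (hC : ∀ g ∈ C, P (cls g)) :
    (A.map (graphElem P)).prod = (Polynomial.X : ℤ[X]) ^ a • (B.map (graphElem P)).prod +
      (c • (Polynomial.X : ℤ[X]) ^ b) • (C.map (graphElem P)).prod := by
  rw [← mk_union_pmap A hA, ← mk_union_pmap B hB, ← mk_union_pmap C hC]
  refine Ideal.Quotient.eq.2 (Ideal.subset_span ⟨_, _, _, A, B, C, a, b, c, h, ?_, ?_, ?_, rfl⟩) <;>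
  rw [Multiset.map_pmap, Multiset.pmap_eq_map]

/-- The induction step for both parts: the left side of the resolution is one graph, so it is a
polynomial in the graphs on the right. -/
theorem graphElem_mem {P : IsoClass → Prop} (S : Subalgebra ℤ[X] (XYQuotient P))
    {g : SBGraph} {B C : Multiset SBGraph} {a b : ℕ} {c : ℤ}
    (h : Resolution {g} a B c b C) (hg : P (cls g))
    (hB : ∀ g ∈ B, P (cls g) ∧ graphElem P g ∈ S) (hC : ∀ g ∈ C, P (cls g) ∧ graphElem P g ∈ S) :
    graphElem P g ∈ S := by
  have key := graphElem_resolution h (by simpa using hg) (fun g hg => (hB g hg).1)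
    (fun g hg => (hC g hg).1)
  simp only [Multiset.map_singleton, Multiset.prod_singleton] at key
  rw [key]
  refine S.add_mem (S.smul_mem (Subalgebra.multiset_prod_mem (A := XYQuotient P) S ?_) _)
    (S.smul_mem (Subalgebra.multiset_prod_mem (A := XYQuotient P) S ?_) _)
  · simpa using fun g hg => (hB g hg).2
  · simpa using fun g hg => (hC g hg).2

theorem eq_top_of_graphElem_mem {P : IsoClass → Prop} (S : Subalgebra ℤ[X] (XYQuotient P))
    (h : ∀ g, P (cls g) → graphElem P g ∈ S) : S = ⊤ := by
  refine (Algebra.eq_top_iff).2 fun z => ?_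
  obtain ⟨p, rfl⟩ := Ideal.Quotient.mk_surjective z
  induction p using MvPolynomial.induction_on with
  | C a => exact S.algebraMap_mem a
  | add p q hp hq => rw [map_add]; exact S.add_mem hp hq
  | mul_X p q hp =>
    rw [map_mul]
    refine S.mul_mem hp ?_
    obtain ⟨⟨g⟩, hq⟩ := q
    have := h g hq
    rwa [graphElem_of hq] at this

/-! ### Snake graphs -/

theorem eq_not_of_ne {a b : Bool} (h : a ≠ b) : a = !b := by
  revert a b
  decide

/-- The trichotomy no, one or several occurrences of `b` matches the three forms of self-grafting in
the last tile. -/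
theorem first_last_decomposition (b : Bool) (w : List Bool) :
    b ∉ w ∨ (∃ A B, w = A ++ b :: B ∧ b ∉ A ∧ b ∉ B) ∨
      ∃ A M B, w = A ++ b :: M ++ b :: B ∧ b ∉ A ∧ b ∉ B := by
  by_cases h : b ∈ w
  · right
    obtain ⟨A, R, rfl, hA⟩ := List.eq_append_cons_of_mem h
    by_cases hR : b ∈ R
    · right
      obtain ⟨B, M, hM, hB⟩ := List.eq_append_cons_of_mem (List.mem_reverse.2 hR)
      refine ⟨A, M.reverse, B.reverse, ?_, hA, by simpa using hB⟩
      have := congrArg List.reverse hM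
      simp only [List.reverse_reverse, List.reverse_append, List.reverse_cons] at this
      simp [this]
    · exact Or.inl ⟨A, R, rfl, hA, hR⟩
  · exact Or.inl h

/-- Stated for general `P` to serve both rings. Only band graphs with both signs are required, since
constant ones are not shown to be unpunctured. -/
theorem snake_mem {P : IsoClass → Prop} (S : Subalgebra ℤ[X] (XYQuotient P))
    (hs : ∀ g, P (cls (.snake g))) (hb : ∀ w b, (!b) ∈ w → P (cls (.band w b)))
    (hed : graphElem P ed ∈ S) (htile : graphElem P (sn []) ∈ S)
    (hband : ∀ w b, (!b) ∈ w → graphElem P (.band w b) ∈ S) (g : Snake) :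
    graphElem P (.snake g) ∈ S := by
  cases g with
  | edge => exact hed
  | tiles w =>
    induction hn : w.length using Nat.strong_induction_on generalizing w with
    | _ n ih =>
      subst hn
      cases w with
      | nil => exact htile
      | cons a v =>
        -- The gluing sign is `!a`, so the band graph contains both `a` and `!a`.
        have hmem : (!(!a)) ∈ a :: v := by simp
        have hB : ∀ g ∈ ({.band (a :: v) (!a), ed} : Multiset SBGraph),
            P (cls g) ∧ graphElem P g ∈ S := by
          intro g hg
          simp only [Multiset.insert_eq_cons, Multiset.mem_cons, Multiset.mem_singleton] at hg
          rcases hg with rfl | rfl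
          · exact ⟨hb _ _ hmem, hband _ _ hmem⟩
          · exact ⟨hs _, hed⟩
        rcases first_last_decomposition (!a) (a :: v) with h | ⟨A, B, h, hA, hB'⟩ |
          ⟨A, M, B, h, hA, hB'⟩
        · exact graphElem_mem S (Or.inr (Or.inr (Or.inr (.self_end_zero _ _ h)))) (hs _) hB
            (by simp)
        · rw [h] at hB ⊢
          exact graphElem_mem S (Or.inr (Or.inr (Or.inr (.self_end_edge _ _ _ hA hB')))) (hs _) hB
            (by simpa using ⟨hs _, hed⟩)
        · have hlen : M.length < (a :: v).length := by
            rw [h]; simp; omega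
          rw [h] at hB ⊢
          exact graphElem_mem S (Or.inr (Or.inr (Or.inr (.self_end _ _ _ _ hA hB')))) (hs _) hB
            (by simpa using ⟨hs _, ih _ hlen M rfl⟩)

/-! ### Band graphs -/

/-- The elementary rotation moves one letter; iterating it along `u` moves the cut of the cyclic
word anywhere. -/
theorem cls_band_rotate {u v w w' : List Bool} {b b' : Bool} (h : w ++ [b] = u ++ v)
    (h' : w' ++ [b'] = v ++ u) : cls (.band w b) = cls (.band w' b') := by
  induction u generalizing v w b with
  | nil =>
    simp only [List.nil_append, List.append_nil] at h h'
    obtain ⟨rfl, h2⟩ := List.append_inj' (h.trans h'.symm) rfl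
    simp only [List.cons.injEq, and_true] at h2
    rw [h2]
  | cons c u ih =>
    cases w with
    | nil =>
      simp only [List.nil_append, List.cons_append, List.cons.injEq] at h
      obtain ⟨rfl, h2⟩ := h
      obtain ⟨rfl, rfl⟩ := List.append_eq_nil_iff.1 h2.symm
      obtain ⟨rfl, h3⟩ := List.append_inj' (s₁ := w') (s₂ := []) h' rfl
      simp only [List.cons.injEq, and_true] at h3
      rw [h3]
    | cons d w =>
      simp only [List.cons_append, List.cons.injEq] at h
      obtain ⟨rfl, h⟩ := h
      refine (Quot.sound (Iso.band_rotate d w b)).trans (ih (v := v ++ [d]) ?_ ?_)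
      · rw [h, List.append_assoc]
      · rw [h']; simp

/-- The alternating word of length `n` with first letter `a`. -/
def alternating (a : Bool) : ℕ → List Bool
  | 0 => []
  | n + 1 => a :: alternating (!a) n

/-- The pair `c :: c` found is the start of a run: the letter before it is `!c`. The added `!x`
stands for the cyclic predecessor of `x`, which matters when `pre` is empty. -/
theorem alternating_or_repetition (x : Bool) (l : List Bool) :
    (∃ n, x :: l = alternating x n) ∨
      ∃ pre c rest, x :: l = pre ++ c :: c :: rest ∧ ((!x) :: pre).getLast? = some (!c) := by
  induction l generalizing x with
  | nil => exact Or.inl ⟨1, rfl⟩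
  | cons y l ih =>
    by_cases hy : y = x
    · subst hy
      exact Or.inr ⟨[], y, l, rfl, rfl⟩
    · have hyx : y = !x := eq_not_of_ne hy
      subst hyx
      rcases ih (!x) with ⟨n, hn⟩ | ⟨pre, c, rest, h, hl⟩
      · exact Or.inl ⟨n + 1, by rw [hn, alternating]⟩
      · refine Or.inr ⟨x :: pre, c, rest, by rw [h]; rfl, ?_⟩
        rw [Bool.not_not] at hl
        rw [← hl, List.getLast?_cons_cons]

/-- The word `x, !x, x, …, x` with `2 * j + 1` letters. -/
def oddAlternating (x : Bool) : ℕ → List Bool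
  | 0 => [x]
  | j + 1 => x :: (!x) :: oddAlternating x j

theorem eq_oddAlternating {x : Bool} {n : ℕ} {w : List Bool}
    (h : alternating x n = w ++ [!x]) : ∃ j, w = oddAlternating x j := by
  induction n using Nat.strong_induction_on generalizing w with
  | _ n ih =>
    match n with
    | 0 => simp [alternating] at h
    | 1 =>
      obtain ⟨_, h2⟩ := List.append_inj' (s₁ := []) (t₁ := [x]) h rfl
      simp at h2
    | 2 =>
      obtain ⟨rfl, _⟩ := List.append_inj' (s₁ := [x]) (t₁ := [!x]) h rfl
      exact ⟨0, rfl⟩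
    | n + 3 =>
      match w with
      | [] => simp [alternating] at h
      | [a] => simp [alternating] at h
      | a :: a' :: w =>
        simp only [alternating, Bool.not_not, List.cons_append, List.cons.injEq] at h
        obtain ⟨rfl, rfl, h⟩ := h
        obtain ⟨j, rfl⟩ := ih (n + 1) (by omega) (w := w) (by simpa [alternating] using h)
        exact ⟨j + 1, rfl⟩

/-- Followed by `!x`, both words are powers of `[x, !x]` and hence commute. This is the condition
for a self-overlap that is the whole band graph. -/
theorem oddAlternating_comm (x : Bool) (j : ℕ) :
    [x] ++ (!x) :: oddAlternating x j = oddAlternating x j ++ (!x) :: [x] := by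
  induction j with
  | zero => rfl
  | succ j ih =>
    simp only [oddAlternating, List.cons_append, List.nil_append] at ih ⊢
    rw [ih]

theorem periodicPrefix_replicate (c : Bool) (k : ℕ) :
    PeriodicPrefix (List.replicate k c ++ [c]) ([] ++ [c]) :=
  ⟨k + 1, by simp [List.replicate_succ']⟩

theorem exists_replicate_append (c : Bool) (l : List Bool) :
    ∃ k Q, l = List.replicate k c ++ Q ∧ ∀ a ∈ Q.head?, a = !c := by
  induction l with
  | nil => exact ⟨0, [], rfl, by simp⟩
  | cons d l ih =>
    by_cases h : d = c
    · obtain ⟨k, Q, rfl, hQ⟩ := ih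
      exact ⟨k + 1, Q, by rw [h]; rfl, hQ⟩
    · refine ⟨0, d :: l, rfl, ?_⟩
      intro a ha
      simp only [List.head?_cons, Option.mem_def, Option.some.injEq] at ha
      exact ha ▸ eq_not_of_ne h

/-- The letters before the first `!b` are all `b`; moved to the end they merge with the closing `b`.
-/
theorem exists_band_rotation (w : List Bool) (b : Bool) (h : (!b) ∈ w) :
    ∃ v, cls (.band w b) = cls (.band ((!b) :: v) b) ∧ v.length + 1 = w.length := by
  obtain ⟨u, v, rfl, hu⟩ := List.eq_append_cons_of_mem h
  have hu' : u = List.replicate u.length b := List.eq_replicate_iff.2 ⟨rfl, fun a ha => by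
    by_contra hab
    exact hu (eq_not_of_ne hab ▸ ha)⟩
  refine ⟨v ++ u, cls_band_rotate (u := u) (v := (!b) :: v ++ [b]) (by simp) ?_, by simp; omega⟩
  rw [hu']
  simp [← List.replicate_succ', ← List.replicate_succ]

theorem band_mem {P : IsoClass → Prop} (S : Subalgebra ℤ[X] (XYQuotient P))
    (hb : ∀ w b, P (cls (.band w b))) (hone : ∀ b, graphElem P (.band [] b) ∈ S)
    (w : List Bool) (b : Bool) : graphElem P (.band w b) ∈ S := by
  induction hn : w.length using Nat.strong_induction_on generalizing w b with
  | _ n ih =>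
  subst hn
  have mem : ∀ {g : SBGraph} {w₁ w₂ : List Bool} {b₁ b₂ : Bool} {c : ℤ} {k : ℕ}
      {C : Multiset SBGraph}, BandSelfResolution {g} 0 {.band w₁ b₁, .band w₂ b₂} c k C →
      P (cls g) → w₁.length < w.length → w₂.length < w.length →
      (∀ g ∈ C, P (cls g) ∧ graphElem P g ∈ S) → graphElem P g ∈ S := by
    intro g w₁ w₂ b₁ b₂ c k C h hg h₁ h₂ hC
    refine graphElem_mem S (Or.inr (Or.inr (Or.inl h))) hg ?_ hC
    intro g' hg'
    simp only [Multiset.insert_eq_cons, Multiset.mem_cons, Multiset.mem_singleton] at hg'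
    rcases hg' with rfl | rfl
    · exact ⟨hb _ _, ih _ h₁ _ _ rfl⟩
    · exact ⟨hb _ _, ih _ h₂ _ _ rfl⟩
  by_cases hconst : (!b) ∈ w
  · obtain ⟨v, hv, hlen⟩ := exists_band_rotation w b hconst
    rcases alternating_or_repetition (!b) (v ++ [b]) with ⟨n, hn⟩ | ⟨pre, c, rest, h, hl⟩
    · rw [graphElem_congr hv]
      obtain ⟨j, hj⟩ := eq_oddAlternating (x := !b) (w := (!b) :: v) (n := n) (by simpa using hn.symm)
      have hjl : (oddAlternating (!b) j).length = w.length := by rw [← hj, ← hlen]; rfl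
      rw [hj]
      -- The cyclic word is the power `j + 1` of `[!b, b]`. For the first power two one-tile band
      -- graphs split off, for the second two copies of the two-tile one, and for higher powers one
      -- such copy. When the last term is `0` as a multiset, it is the empty union, that is, the
      -- unit of the ring.
      match j, hjl with
      | 0, hjl =>
        rw [← hlen] at hjl
        have := BandSelfResolution.adjacent_both [] (!b)
        rw [Bool.not_not] at this
        exact mem this (hb _ _) (by simp; omega) (by simp; omega) (by simp)
      | 1, hjl =>
        simp only [oddAlternating, List.length_cons, List.length_nil] at hjl
        have hw : oddAlternating (!b) 1 = [!b] ++ b :: [!b] := by simp [oddAlternating]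
        rw [hw]
        exact mem (BandSelfResolution.double [!b] b) (hb _ _) (by simp; omega) (by simp; omega) (by simp)
      | j + 2, hjl =>
        simp only [oddAlternating, List.length_cons] at hjl
        have hc := oddAlternating_comm (!b) j
        rw [Bool.not_not] at hc
        have := BandSelfResolution.whole [!b] (oddAlternating (!b) j) b hc
        have hw : oddAlternating (!b) (j + 2) =
            [!b] ++ b :: [!b] ++ b :: oddAlternating (!b) j := by
          simp [oddAlternating]
        rw [hw]
        exact mem this (hb _ _) (by simp; omega) (by simp; omega)
          (by simpa using ⟨hb _ _, ih _ (by omega) _ _ rfl⟩)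
    -- Cut the cyclic word just before the run, so that it begins with `c, c` and closes with `!c`.
    · have hrot : ∃ Z, cls (.band w b) = cls (.band (c :: c :: Z) (!c)) ∧
          Z.length + 2 = w.length := by
        rcases List.eq_nil_or_concat pre with rfl | ⟨pre', d, rfl⟩
        · simp only [List.getLast?_singleton, Bool.not_not, Option.some.injEq] at hl
          subst hl
          rw [Bool.not_not] at h
          rcases List.eq_nil_or_concat rest with rfl | ⟨Z, d, rfl⟩
          -- The word ends in `!c`, so it cannot stop right after the pair.
          · exfalso
            obtain ⟨_, h2⟩ := List.append_inj' (s₁ := c :: v) (t₁ := [!c]) (s₂ := [c])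
              (t₂ := [c]) h rfl
            simp at h2
          · obtain ⟨h1, _⟩ := List.append_inj' (s₁ := c :: v) (s₂ := c :: c :: Z)
              (t₁ := [!c]) (t₂ := [d]) (by simpa using h) rfl
            rw [Bool.not_not, h1] at hv
            exact ⟨Z, hv, by rw [← hlen]; simpa using (congrArg List.length h1).symm⟩
        · have hd : d = !c := by
            rw [List.concat_eq_append, ← List.cons_append, List.getLast?_concat] at hl
            exact Option.some.inj hl
          subst hd
          refine ⟨rest ++ pre', hv.trans (cls_band_rotate (u := pre'.concat (!c))
            (v := c :: c :: rest) (by simpa using h) (by simp)), ?_⟩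
          have := congrArg List.length h
          simp at this ⊢
          omega
      obtain ⟨Z, hZ, hZlen⟩ := hrot
      rw [graphElem_congr hZ]
      -- The overlap must extend to the end of the run: with `U` empty, `Y` consists of the
      -- remaining `k` letters `c`, and `Q` is empty or begins with `!c`.
      obtain ⟨k, Q, rfl, hQ⟩ := exists_replicate_append c Z
      have := BandSelfResolution.overlapping [] (List.replicate k c) Q c hQ
        (periodicPrefix_replicate c k)
      exact mem this (hb _ _) (by simp at hZlen ⊢; omega) (by simp; omega)
        (by simpa using ⟨hb _ _, ih _ (by omega) _ _ rfl⟩)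
  · have hw : w = List.replicate w.length b := List.eq_replicate_iff.2 ⟨rfl, fun a ha => by
      by_contra hab
      exact hconst (eq_not_of_ne hab ▸ ha)⟩
    generalize hk : w.length = k at *
    match k with
    | 0 => rw [hw]; exact hone b
    | 1 =>
      rw [hw]
      exact mem (BandSelfResolution.double [] b) (hb _ _) (by simp) (by simp) (by simp)
    | k + 2 =>
      rw [hw]
      -- A constant word is a power of `[b]`; one one-tile band graph splits off.
      have := BandSelfResolution.whole [] (List.replicate k b) b
        (by simp [← List.replicate_succ', ← List.replicate_succ])
      exact mem this (hb _ _) (by simp) (by simp)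
        (by simpa using ⟨hb _ _, ih k (by omega) _ _ (by simp)⟩)

end

end SnakeCalc

/-! ### The two generation statements -/

theorem mainTheorem9 :
    Algebra.adjoin (Polynomial ℤ) (SnakeCalc.generators SnakeCalc.Unpunctured
        ({SnakeCalc.SBGraph.snake .edge, SnakeCalc.SBGraph.snake (.tiles [])} ∪
          {g | ∃ w b, g = SnakeCalc.SBGraph.band w b})) =
      (⊤ : Subalgebra (Polynomial ℤ) SnakeCalc.XYS) ∧
    Algebra.adjoin (Polynomial ℤ) (SnakeCalc.generators SnakeCalc.Geometric
        {g | g = SnakeCalc.SBGraph.snake .edge ∨ ∃ b, g = SnakeCalc.SBGraph.band [] b}) =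
      (⊤ : Subalgebra (Polynomial ℤ) SnakeCalc.XYSgeo) := by
  open SnakeCalc in
  constructor
  · refine eq_top_of_graphElem_mem _ ?_
    have gen : ∀ g, Unpunctured (cls g) →
        g ∈ ({.snake .edge, .snake (.tiles [])} ∪ {g | ∃ w b, g = .band w b} : Set SBGraph) →
        graphElem Unpunctured g ∈ Algebra.adjoin (Polynomial ℤ) (generators Unpunctured
          ({.snake .edge, .snake (.tiles [])} ∪ {g | ∃ w b, g = .band w b})) :=
      fun g h hg => Algebra.subset_adjoin ⟨g, h, hg, graphElem_of h⟩
    rintro (g | ⟨w, b⟩) h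
    · exact snake_mem _ unpunctured_snake unpunctured_band (gen _ (unpunctured_snake _) (by simp))
        (gen _ (unpunctured_snake _) (by simp))
        (fun w b hw => gen _ (unpunctured_band w b hw) (Or.inr ⟨w, b, rfl⟩)) g
    · exact gen _ h (Or.inr ⟨w, b, rfl⟩)
  · refine eq_top_of_graphElem_mem _ ?_
    have gen : ∀ g, Geometric (cls g) → (g = .snake .edge ∨ ∃ b, g = .band [] b) →
        graphElem Geometric g ∈ Algebra.adjoin (Polynomial ℤ) (generators Geometric
          {g | g = .snake .edge ∨ ∃ b, g = .band [] b}) :=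
      fun g h hg => Algebra.subset_adjoin ⟨g, h, hg, graphElem_of h⟩
    have hed := gen ed (geometric_snake _) (Or.inl rfl)
    have hone := fun b => gen (.band [] b) (geometric_band _ _) (Or.inr ⟨b, rfl⟩)
    have hband := band_mem _ geometric_band hone
    rintro (g | ⟨w, b⟩) _
    · refine snake_mem _ geometric_snake (fun w b _ => geometric_band w b) hed ?_
        (fun w b _ => hband w b) g
      -- Self-grafting the single tile has no second term, so the tile is the one-tile band graph
      -- times the single edge.
      refine graphElem_mem _ (Or.inr (Or.inr (Or.inr (.self_end_zero [] true (by simp)))))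
        (geometric_snake _) ?_ (by simp)
      intro g hg
      simp only [Multiset.insert_eq_cons, Multiset.mem_cons, Multiset.mem_singleton] at hg
      rcases hg with rfl | rfl
      · exact ⟨geometric_band _ _, hone _⟩
      · exact ⟨geometric_snake _, hed⟩
    · exact hband w b
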